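/- **Conventions.** A class of groups is always assumed closed under isomorphism. Let $\mathcal C$ be a class of groups closed under subgroups of finite index. A (real-valued) Euler characteristic on $\mathcal C$ is a map $\chi:\mathcal C\to\mathbb R$ such that $\chi(G_1)=\chi(G_2)$ whenever $G_1,G_2\in\mathcal C$ are isomorphic, and $\chi(K)=[G:K]\,\chi(G)$ whenever $G\in\mathcal C$ and $K$ is a subgroup of finite index in $G$. A group $G$ is *virtually in $\mathcal C$* if it has a finite-index subgroup $K$ with $K\in\mathcal C$; in that case one sets $\chi(G)=\chi(K)/[G:K]$. This does not depend on the choice of $K$ and extends $\chi$ from $\mathcal C$ to all groups that are virtually in $\mathcal C$. A group is *virtually torsion free* if it has a finite-index subgroup with no non-trivial element of finite order. **Theorem 3.5.** Let $\mathcal C$ be a class of groups closed under free products (of two groups) and under subgroups of finite index, and suppose that $\mathcal C$ contains the infinite cyclic group $\mathbb Z$. Let $\chi:\mathcal C\to\mathbb R$ be an Euler characteristic such that $\chi(A*B)=\chi(A)+\chi(B)-1$ for all $A,B\in\mathcal C$. (i) Let $G\in\mathcal C$ be residually finite or virtually torsion free, let $H$ be a finite subgroup of $G$, let $\varphi:H\to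 G$ be an injective homomorphism, and let $G*_H$ be the HNN extension of $G$ relative to $\varphi$. Then $G*_H$ is virtually in $\mathcal C$ and $$\chi(G*_H)=\chi(G)-\frac1{|H|}.$$ (ii) Let $G_1,G_2\in\mathcal C$, each of which is residually finite or virtually torsion free, let $H$ be a finite group with injective homomorphisms $H\to G_1$ and $H\to G_2$, and let $G_1*_HG_2$ be the corresponding amalgamated free product. Then $G_1*_HG_2$ is virtually in $\mathcal C$ and $$\chi(G_1*_HG_2)=\chi(G_1)+\chi(G_2)-\frac1{|H|}.$$ -/

import Mathlib

universe u

/-- A class of groups: a predicate on groups which is invariant under isomorphism. -/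
def IsGroupClass (C : (G : Type u) → [Group G] → Prop) : Prop :=
  ∀ (G₁ G₂ : Type u) [Group G₁] [Group G₂], Nonempty (G₁ ≃* G₂) → C G₁ → C G₂

/-- The class `C` is closed under subgroups of finite index. -/
def ClosedUnderFiniteIndex (C : (G : Type u) → [Group G] → Prop) : Prop :=
  ∀ (G : Type u) [Group G], C G → ∀ K : Subgroup G, K.FiniteIndex → C K

/-- The class `C` is closed under (binary) free products. -/
def ClosedUnderFreeProducts (C : (G : Type u) → [Group G] → Prop) : Prop :=
  ∀ (A B : Type u) [Group A] [Group B], C A → C B → C (Monoid.Coprod A B)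

/-- `χ` is a real-valued Euler characteristic on the class `C`.
A map `C → ℝ` is given by a function on all groups of which only the values on members of `C`
are ever constrained or used. -/
structure IsEulerCharacteristic (C : (G : Type u) → [Group G] → Prop)
    (χ : (G : Type u) → [Group G] → ℝ) : Prop where
  /-- `χ` is an isomorphism invariant on `C`. -/
  iso_inv : ∀ (G₁ G₂ : Type u) [Group G₁] [Group G₂], C G₁ → C G₂ →
    Nonempty (G₁ ≃* G₂) → χ G₁ = χ G₂
  /-- `χ(K) = [G : K] χ(G)` for every subgroup `K` of finite index. -/
  index_mul : ∀ (G : Type u) [Group G], C G → ∀ K : Subgroup G, K.FiniteIndex →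
    χ K = (K.index : ℝ) * χ G

/-- `G` is virtually in `C`: some subgroup of finite index belongs to `C`. -/
def VirtuallyIn (C : (G : Type u) → [Group G] → Prop) (G : Type u) [Group G] : Prop :=
  ∃ K : Subgroup G, K.FiniteIndex ∧ C K

/-- `G` is virtually torsion free: some subgroup of finite index has no nontrivial element of
finite order. -/
def VirtuallyTorsionFree (G : Type u) [Group G] : Prop :=
  ∃ K : Subgroup G, K.FiniteIndex ∧ ∀ g ∈ K, IsOfFinOrder g → g = 1

open Classical in
/-- Wall's extension of `χ` to groups which are virtually in `C`: `χ(K) / [G : K]` for a subgroup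
`K` of finite index in `C`. By `wallExtension_eq` below the choice of `K` does not matter. (The
value is `0` on groups which are not virtually in `C`.) -/
noncomputable def wallExtension (C : (G : Type u) → [Group G] → Prop)
    (χ : (G : Type u) → [Group G] → ℝ) (G : Type u) [Group G] : ℝ :=
  if h : ∃ K : Subgroup G, K.FiniteIndex ∧ C K then χ h.choose / (h.choose.index : ℝ) else 0

/-- Two subgroups of finite index in `C` give the same quotient `χ(K) / [G : K]`. -/
theorem IsEulerCharacteristic.div_index_eq {C : (G : Type u) → [Group G] → Prop}
    {χ : (G : Type u) → [Group G] → ℝ} (hC : ClosedUnderFiniteIndex C) (hiso : IsGroupClass C)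
    (hχ : IsEulerCharacteristic C χ) {G : Type u} [Group G] (K L : Subgroup G)
    (hK : K.FiniteIndex) (hL : L.FiniteIndex) (hCK : C K) (hCL : C L) :
    χ K / (K.index : ℝ) = χ L / (L.index : ℝ) := by
  have key : ∀ M N : Subgroup G, M.FiniteIndex → N.FiniteIndex → C M →
      C (M ⊓ N : Subgroup G) ∧
        χ M / (M.index : ℝ) = χ (M ⊓ N : Subgroup G) / ((M ⊓ N).index : ℝ) := by
    intro M N hM hN hCM
    have hfi : ((M ⊓ N).subgroupOf M).FiniteIndex := inferInstance
    have e : ((M ⊓ N).subgroupOf M) ≃* (M ⊓ N : Subgroup G) :=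
      Subgroup.subgroupOfEquivOfLe inf_le_left
    have h1 : C ((M ⊓ N).subgroupOf M) := hC M hCM _ hfi
    have h2 : C (M ⊓ N : Subgroup G) := hiso _ _ ⟨e⟩ h1
    refine ⟨h2, ?_⟩
    have h3 := hχ.index_mul M hCM _ hfi
    rw [hχ.iso_inv _ _ h1 h2 ⟨e⟩] at h3
    have h4 : ((M ⊓ N).subgroupOf M).index * M.index = (M ⊓ N).index :=
      Subgroup.relIndex_mul_index inf_le_left
    have h5 : (((M ⊓ N).subgroupOf M).index : ℝ) ≠ 0 := Nat.cast_ne_zero.2 hfi.index_ne_zero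
    have h6 : (M.index : ℝ) ≠ 0 := Nat.cast_ne_zero.2 hM.index_ne_zero
    rw [h3, ← h4]
    push_cast
    field_simp
  have h1 := (key K L hK hL hCK).2
  have h2 := (key L K hL hK hCL).2
  rw [inf_comm] at h2
  rw [h1, h2]

/-- Wall's extension is well defined. -/
theorem wallExtension_eq {C : (G : Type u) → [Group G] → Prop}
    {χ : (G : Type u) → [Group G] → ℝ} (hC : ClosedUnderFiniteIndex C) (hiso : IsGroupClass C)
    (hχ : IsEulerCharacteristic C χ) {G : Type u} [Group G] (K : Subgroup G)
    (hK : K.FiniteIndex) (hCK : C K) :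
    wallExtension C χ G = χ K / (K.index : ℝ) := by
  have h : ∃ K : Subgroup G, K.FiniteIndex ∧ C K := ⟨K, hK, hCK⟩
  rw [wallExtension, dif_pos h]
  exact hχ.div_index_eq hC hiso _ _ h.choose_spec.1 hK h.choose_spec.2 hCK

/-- Wall's extension agrees with `χ` on the members of `C`. -/
theorem wallExtension_of_mem {C : (G : Type u) → [Group G] → Prop}
    {χ : (G : Type u) → [Group G] → ℝ} (hC : ClosedUnderFiniteIndex C) (hiso : IsGroupClass C)
    (hχ : IsEulerCharacteristic C χ) {G : Type u} [Group G] (hG : C G) :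
    wallExtension C χ G = χ G := by
  have h : C (⊤ : Subgroup G) := hiso _ _ ⟨Subgroup.topEquiv.symm⟩ hG
  rw [wallExtension_eq hC hiso hχ (⊤ : Subgroup G) inferInstance h,
    hχ.iso_inv _ _ h hG ⟨Subgroup.topEquiv⟩]
  simp

/-!
An HNN extension or an amalgamated product over a finite group `H` is a group `Γ` split along one
edge. The torsion of the vertex groups survives in suitable finite quotients, so `Γ` acts on a
finite set `X` on which `H` acts freely. By Bass–Serre theory a point stabilizer is then the
fundamental group of a graph of groups with trivial edge groups: a free product of finite-index
subgroups of the vertex groups and of a free group. Its Euler characteristic is therefore known,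
and dividing it by `|X|` gives the formula.

The Bass–Serre step needs no tree. If `P` is the expected stabilizer, then cocycles `G i → X → P`
which become coboundaries in `Γ` let `Γ` act on `X × P`, simply transitively and commuting with
the right translations by `P`.
-/

open Monoid MulAction

/-- Free products do not depend on the indexing of their factors. -/
def coprodIReindex {ι κ : Type*} (e : ι ≃ κ) (A : κ → Type*) [∀ j, Group (A j)] :
    CoprodI (fun i => A (e i)) ≃* CoprodI A :=
  MonoidHom.toMulEquiv (CoprodI.lift fun i => CoprodI.of (i := e i))
    (CoprodI.lift <| Equiv.piCongrLeft (fun j => A j →* CoprodI fun i => A (e i)) e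
      fun i => CoprodI.of (M := fun i => A (e i)) (i := i))
    (by ext i; simp [Equiv.piCongrLeft_apply_apply])
    (by ext j; obtain ⟨i, rfl⟩ := e.surjective j; simp [Equiv.piCongrLeft_apply_apply])

/-- One factor split off a free product. -/
def coprodIOptionEquiv {ι : Type*} (A : Option ι → Type*) [∀ i, Group (A i)] :
    CoprodI A ≃* Coprod (A none) (CoprodI fun i => A (some i)) :=
  MonoidHom.toMulEquiv
    (CoprodI.lift fun
      | none => Coprod.inl
      | some i => Coprod.inr.comp (CoprodI.of (M := fun i => A (some i)) (i := i)))
    (Coprod.lift CoprodI.of (CoprodI.lift fun i => CoprodI.of (i := some i)))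
    (by ext (_ | i) <;> simp)
    (by ext <;> simp)

/-- The free product with no factors is trivial. -/
def coprodCoprodIOfIsEmpty {ι : Type*} [IsEmpty ι] (B : Type*) [Group B] (A : ι → Type*)
    [∀ i, Group (A i)] : Coprod B (CoprodI A) ≃* B :=
  MonoidHom.toMulEquiv (Coprod.lift (MonoidHom.id B) 1) Coprod.inl
    (Coprod.hom_ext (by ext; simp) (CoprodI.ext_hom _ _ isEmptyElim))
    (by ext; simp)

/-- A free group is a free product of infinite cyclic groups. -/
def freeGroupEquivCoprodIInt (E : Type u) :
    FreeGroup E ≃* CoprodI fun _ : E => ULift.{u} (Multiplicative ℤ) :=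
  let u : ULift.{u} (Multiplicative ℤ) ≃* Multiplicative ℤ := MulEquiv.ulift
  MonoidHom.toMulEquiv
    (FreeGroup.lift fun e => CoprodI.of (M := fun _ : E => ULift.{u} (Multiplicative ℤ)) (i := e)
      (u.symm (Multiplicative.ofAdd 1)))
    (CoprodI.lift fun e => (zpowersHom _ (FreeGroup.of e)).comp u.toMonoidHom)
    (by ext e; simp [zpowersHom_apply])
    (CoprodI.ext_hom _ _ fun e => (MonoidHom.cancel_right (f := u.symm.toMonoidHom)
      u.symm.surjective).1 (MonoidHom.ext_mint (by simp [zpowersHom_apply])))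

/-- A pair `(C, χ)` as in the theorem: an Euler characteristic `χ` on a class `C` containing `ℤ`
and closed under free products and finite-index subgroups, with `χ (A * B) = χ A + χ B - 1`. -/
structure IsFreelyAdditive (C : (G : Type u) → [Group G] → Prop)
    (χ : (G : Type u) → [Group G] → ℝ) : Prop where
  isGroupClass : IsGroupClass C
  closedUnderFreeProducts : ClosedUnderFreeProducts C
  closedUnderFiniteIndex : ClosedUnderFiniteIndex C
  int_mem : C (ULift.{u} (Multiplicative ℤ))
  isEulerCharacteristic : IsEulerCharacteristic C χ
  coprod_eq : ∀ (A B : Type u) [Group A] [Group B], C A → C B →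
    χ (Coprod A B) = χ A + χ B - 1

/-- `G` belongs to `C` and has Euler characteristic `r`. -/
def HasEuler (C : (G : Type u) → [Group G] → Prop) (χ : (G : Type u) → [Group G] → ℝ)
    (G : Type u) [Group G] (r : ℝ) : Prop :=
  C G ∧ χ G = r

theorem sum_index_stabilizer {G X : Type*} [Group G] [MulAction G X] [Finite X]
    [Fintype (orbitRel.Quotient G X)] :
    ∑ v : orbitRel.Quotient G X, (stabilizer G v.out).index = Nat.card X := by
  have (x : X) : Finite (G ⧸ stabilizer G x) := .of_equiv _ (orbitEquivQuotientStabilizer G x)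
  rw [Nat.card_congr (selfEquivSigmaOrbitsQuotientStabilizer G X), Nat.card_sigma]
  rfl

theorem finiteIndex_stabilizer {G X : Type*} [Group G] [MulAction G X] [Finite X] (x : X) :
    (stabilizer G x).FiniteIndex :=
  ⟨by rw [index_stabilizer]; exact ((nonempty_orbit x).ncard_pos (Set.toFinite _)).ne'⟩

namespace IsFreelyAdditive

variable {C : (G : Type u) → [Group G] → Prop} {χ : (G : Type u) → [Group G] → ℝ}

theorem hasEuler_congr (h : IsFreelyAdditive C χ) {A B : Type u} [Group A] [Group B]
    (e : A ≃* B) {r : ℝ} (hA : HasEuler C χ A r) : HasEuler C χ B r :=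
  have hB := h.isGroupClass A B ⟨e⟩ hA.1
  ⟨hB, (h.isEulerCharacteristic.iso_inv A B hA.1 hB ⟨e⟩).symm.trans hA.2⟩

theorem hasEuler_coprod (h : IsFreelyAdditive C χ) {A B : Type u} [Group A] [Group B]
    {r s : ℝ} (hA : HasEuler C χ A r) (hB : HasEuler C χ B s) :
    HasEuler C χ (Coprod A B) (r + s - 1) :=
  ⟨h.closedUnderFreeProducts A B hA.1 hB.1, by rw [h.coprod_eq A B hA.1 hB.1, hA.2, hB.2]⟩

theorem hasEuler_subgroup (h : IsFreelyAdditive C χ) {A : Type u} [Group A] (hA : C A)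
    (K : Subgroup A) [hK : K.FiniteIndex] : HasEuler C χ K (K.index * χ A) :=
  ⟨h.closedUnderFiniteIndex A hA K hK, h.isEulerCharacteristic.index_mul A hA K hK⟩

theorem hasEuler_int (h : IsFreelyAdditive C χ) :
    HasEuler C χ (ULift.{u} (Multiplicative ℤ)) 0 := by
  let Z := ULift.{u} (Multiplicative ℤ)
  let K : Subgroup Z := (AddSubgroup.zmultiples (2 : ℤ)).toSubgroup.comap
    (MulEquiv.ulift : Z ≃* Multiplicative ℤ).toMonoidHom
  have hK : K.index = 2 := by
    rw [Subgroup.index_comap_of_surjective _ MulEquiv.ulift.surjective]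
    exact Int.index_zmultiples 2
  have : K.FiniteIndex := ⟨by rw [hK]; norm_num⟩
  have : IsCyclic Z := isCyclic_of_surjective MulEquiv.ulift.symm MulEquiv.ulift.symm.surjective
  have e : K ≃* Z := mulEquivOfCyclicCardEq (by simpa [hK, Z] using K.card_mul_index)
  have hχ := (h.hasEuler_congr e (h.hasEuler_subgroup h.int_mem K)).2
  rw [hK, Nat.cast_ofNat] at hχ
  exact ⟨h.int_mem, by linarith⟩

theorem hasEuler_coprod_coprodI (h : IsFreelyAdditive C χ) {ι : Type u} [Fintype ι] :
    ∀ {B : Type u} [Group B] {r : ℝ} {A : ι → Type u} [∀ i, Group (A i)] {s : ι → ℝ},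
      HasEuler C χ B r → (∀ i, HasEuler C χ (A i) (s i)) →
        HasEuler C χ (Coprod B (CoprodI A)) (r + ∑ i, (s i - 1)) := by
  refine Fintype.induction_empty_option (P := fun ι _ => ∀ {B : Type u} [Group B] {r : ℝ}
    {A : ι → Type u} [∀ i, Group (A i)] {s : ι → ℝ}, HasEuler C χ B r →
      (∀ i, HasEuler C χ (A i) (s i)) →
        HasEuler C χ (Coprod B (CoprodI A)) (r + ∑ i, (s i - 1))) ?_ ?_ ?_ ι
  · intro ι κ _ e ih B _ r A _ s hB hA
    let _ := Fintype.ofEquiv κ e.symm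
    rw [← e.sum_comp fun i => s i - 1]
    exact h.hasEuler_congr (MulEquiv.coprodCongr (MulEquiv.refl B) (coprodIReindex e A))
      (ih hB fun i => hA (e i))
  · intro B _ r A _ s hB _
    simpa using h.hasEuler_congr (coprodCoprodIOfIsEmpty B A).symm hB
  · intro ι _ ih B _ r A _ s hB hA
    have key := h.hasEuler_congr ((MulEquiv.coprodAssoc _ _ _).trans
      (MulEquiv.coprodCongr (MulEquiv.refl B) (coprodIOptionEquiv A).symm))
      (ih (h.hasEuler_coprod hB (hA none)) fun i => hA (some i))
    rw [Fintype.sum_option]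
    convert key using 1
    ring

theorem hasEuler_coprodI (h : IsFreelyAdditive C χ) {ι : Type u} [Fintype ι] [Nonempty ι]
    {A : ι → Type u} [∀ i, Group (A i)] {s : ι → ℝ} (hA : ∀ i, HasEuler C χ (A i) (s i)) :
    HasEuler C χ (CoprodI A) (1 + ∑ i, (s i - 1)) := by
  classical
  let e := Equiv.optionSubtypeNe (Classical.arbitrary ι)
  have key := h.hasEuler_congr
    ((coprodIOptionEquiv fun i => A (e i)).symm.trans (coprodIReindex e A))
    (h.hasEuler_coprod_coprodI (hA (e none)) fun i => hA (e (some i)))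
  rw [← e.sum_comp fun i => s i - 1, Fintype.sum_option]
  convert key using 1
  ring

theorem hasEuler_coprod_freeGroup (h : IsFreelyAdditive C χ) {B : Type u} [Group B] {r : ℝ}
    (hB : HasEuler C χ B r) (E : Type u) [Finite E] :
    HasEuler C χ (Coprod B (FreeGroup E)) (r - Nat.card E) := by
  have := Fintype.ofFinite E
  have key := h.hasEuler_congr
    (MulEquiv.coprodCongr (MulEquiv.refl B) (freeGroupEquivCoprodIInt E).symm)
    (h.hasEuler_coprod_coprodI hB fun _ => h.hasEuler_int)
  simpa [sub_eq_add_neg] using key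

theorem wallExtension_of_transitive (h : IsFreelyAdditive C χ) {Γ X P : Type u} [Group Γ]
    [MulAction Γ X] [IsPretransitive Γ X] [Finite X] [Group P] {r : ℝ}
    (hP : HasEuler C χ P r) {x : X} (e : stabilizer Γ x ≃* P) :
    VirtuallyIn C Γ ∧ wallExtension C χ Γ = r / Nat.card X := by
  have hfin := finiteIndex_stabilizer (G := Γ) x
  have hK := h.hasEuler_congr e.symm hP
  refine ⟨⟨_, hfin, hK.1⟩, ?_⟩
  rw [wallExtension_eq h.closedUnderFiniteIndex h.isGroupClass h.isEulerCharacteristic _ hfin hK.1,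
    hK.2, index_stabilizer_of_transitive]

end IsFreelyAdditive

section Torsor

variable {Γ X P : Type*} [Group Γ] [Group P] [MulAction Γ X]

theorem nonempty_stabilizer_mulEquiv_of_torsor (F : Γ →* Equiv.Perm (X × P)) (x₀ : X)
    (hfst : ∀ γ z, (F γ z).1 = γ • z.1)
    (hmul : ∀ γ x p q, F γ (x, p * q) = ((F γ (x, p)).1, (F γ (x, p)).2 * q))
    (hfree : ∀ γ z, F γ z = z → γ = 1) (htrans : ∀ z, ∃ γ, F γ (x₀, 1) = z) :
    Nonempty (stabilizer Γ x₀ ≃* P) := by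
  have hfib (γ : stabilizer Γ x₀) : F γ (x₀, 1) = (x₀, (F γ (x₀, 1)).2) :=
    Prod.ext ((hfst γ _).trans γ.2) rfl
  let f : stabilizer Γ x₀ →* P := MonoidHom.mk' (fun γ => (F γ (x₀, 1)).2) fun γ δ => by
    rw [Subgroup.coe_mul, map_mul, Equiv.Perm.mul_apply, hfib δ]
    simpa using congrArg Prod.snd (hmul γ x₀ 1 (F δ (x₀, 1)).2)
  refine ⟨MulEquiv.ofBijective f ⟨(injective_iff_map_eq_one f).2 fun γ hγ => ?_, fun p => ?_⟩⟩
  · exact Subtype.ext (hfree γ (x₀, 1) ((hfib γ).trans (Prod.ext rfl hγ)))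
  · obtain ⟨γ, hγ⟩ := htrans (x₀, p)
    exact ⟨⟨γ, (hfst γ (x₀, 1)).symm.trans (congrArg Prod.fst hγ)⟩, congrArg Prod.snd hγ⟩

end Torsor

section OrbitSection

variable (G : Type*) {X : Type*} [Group G] [MulAction G X]

/-- The orbit of `x`, as a point of the orbit space. -/
def orbitClass (x : X) : orbitRel.Quotient G X :=
  Quotient.mk _ x

variable {G}

@[simp]
theorem orbitClass_smul (g : G) (x : X) : orbitClass G (g • x) = orbitClass G x :=
  orbitRel.Quotient.quotient_smul_eq

@[simp]
theorem orbitClass_out (v : orbitRel.Quotient G X) : orbitClass G v.out = v :=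
  Quotient.out_eq v

variable (G X) in
theorem exists_orbitSection : ∃ s : X → G, (∀ x, s x • (orbitClass G x).out = x) ∧
    ∀ v : orbitRel.Quotient G X, s v.out = 1 := by
  have hout (x : X) : ∃ g : G, g • (orbitClass G x).out = x :=
    orbitRel_apply.1 (Quotient.exact (orbitClass_out (orbitClass G x)).symm)
  choose s hs using hout
  refine ⟨fun x => s x * (s (orbitClass G x).out)⁻¹, fun x => ?_, fun v => by simp⟩
  have hx := hs (orbitClass G x).out
  rw [orbitClass_out] at hx
  rw [mul_smul, inv_smul_eq_iff.2 hx.symm, hs]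

variable (G) in
/-- A group element carrying the representative of the orbit of `x` to `x`, normalised to be `1`
at the representatives. -/
noncomputable def orbitSection (x : X) : G :=
  (exists_orbitSection G X).choose x

@[simp]
theorem orbitSection_smul_out (x : X) : orbitSection G x • (orbitClass G x).out = x :=
  (exists_orbitSection G X).choose_spec.1 x

@[simp]
theorem orbitSection_out (v : orbitRel.Quotient G X) : orbitSection G v.out = 1 :=
  (exists_orbitSection G X).choose_spec.2 v

theorem orbitSection_conj_mem (g : G) (x : X) :
    (orbitSection G (g • x))⁻¹ * g * orbitSection G x ∈ stabilizer G (orbitClass G x).out := by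
  have h := orbitSection_smul_out (G := G) (g • x)
  rw [orbitClass_smul] at h
  rw [mem_stabilizer_iff, mul_smul, orbitSection_smul_out, mul_smul, inv_smul_eq_iff, h]

end OrbitSection

section Cocycle

variable {G X P : Type*} [Group G] [MulAction G X] [Group P]

/-- `d` is a cocycle for the action of `G` on `X`, with values in `P`. -/
def IsCocycle (d : G → X → P) : Prop :=
  ∀ g h x, d (g * h) x = d g (h • x) * d h x

theorem IsCocycle.one {d : G → X → P} (hd : IsCocycle d) (x : X) : d 1 x = 1 := by
  simpa using hd 1 1 x

/-- The fibrewise left translation of `X × P` over a permutation of `X`. -/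
@[simps]
def skewPerm (t : Equiv.Perm X) (e : X → P) : Equiv.Perm (X × P) where
  toFun z := (t z.1, e z.1 * z.2)
  invFun z := (t.symm z.1, (e (t.symm z.1))⁻¹ * z.2)
  left_inv z := by simp
  right_inv z := by simp

/-- The action of `G` on `X × P` twisted by a cocycle. -/
@[simps]
def skewHom {d : G → X → P} (hd : IsCocycle d) : G →* Equiv.Perm (X × P) where
  toFun g := skewPerm (MulAction.toPerm g) (d g)
  map_one' := by ext z <;> simp [hd.one]
  map_mul' g h := by ext z <;> simp [hd g h, mul_smul, mul_assoc]

variable (f : ∀ v : orbitRel.Quotient G X, stabilizer G v.out →* P)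

/-- The cocycle assembled from homomorphisms defined on the stabilizers of the orbit
representatives. -/
noncomputable def orbitCocycle (g : G) (x : X) : P :=
  f (orbitClass G x) ⟨_, orbitSection_conj_mem g x⟩

theorem stabilizer_hom_congr {v w : orbitRel.Quotient G X} (h : v = w) {a b : G} (hab : a = b)
    (ha : a ∈ stabilizer G v.out) (hb : b ∈ stabilizer G w.out) : f v ⟨a, ha⟩ = f w ⟨b, hb⟩ := by
  subst h hab; rfl

theorem isCocycle_orbitCocycle : IsCocycle (orbitCocycle f) := by
  intro g h x
  have hmem := orbitSection_conj_mem g (h • x)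
  rw [orbitClass_smul] at hmem
  have hgh : orbitCocycle f g (h • x) = f (orbitClass G x) ⟨_, hmem⟩ :=
    stabilizer_hom_congr f (orbitClass_smul h x) rfl _ _
  rw [hgh, orbitCocycle, orbitCocycle, ← map_mul]
  refine congrArg _ (Subtype.ext ?_)
  simp only [mul_smul, Subgroup.coe_mul]
  group

theorem orbitCocycle_stabilizer (v : orbitRel.Quotient G X) (a : stabilizer G v.out) :
    orbitCocycle f a v.out = f v a := by
  refine stabilizer_hom_congr f (orbitClass_out v) ?_ _ a.2
  simp [mem_stabilizer_iff.1 a.2]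

theorem orbitCocycle_orbitSection (x : X) :
    orbitCocycle f (orbitSection G x) (orbitClass G x).out = 1 := by
  rw [← map_one (f (orbitClass G x))]
  exact stabilizer_hom_congr f (orbitClass_out _) (by simp) _ (one_mem _)

theorem map_orbitCocycle {Γ : Type*} [Group Γ] (Ψ : P →* Γ) (j : G →* Γ)
    (σ : orbitRel.Quotient G X → Γ)
    (hΨ : ∀ v (a : stabilizer G v.out), Ψ (f v a) = (σ v)⁻¹ * j a * σ v) (g : G) (x : X) :
    Ψ (orbitCocycle f g x) = (j (orbitSection G (g • x)) * σ (orbitClass G (g • x)))⁻¹ * j g *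
      (j (orbitSection G x) * σ (orbitClass G x)) := by
  rw [orbitCocycle, hΨ, orbitClass_smul]
  simp only [map_mul, map_inv]
  group

end Cocycle

section FreeAction

variable {H A B X P : Type*} [Group H] [MulAction H A] [MulAction H B] [MulAction H X] [Group P]
  [IsCancelSMul H A] [IsCancelSMul H B] [IsCancelSMul H X]

theorem orbitSection_smul (h : H) (x : X) : orbitSection H (h • x) = h * orbitSection H x := by
  have hx := orbitSection_smul_out (G := H) (h • x)
  rw [orbitClass_smul] at hx
  exact IsCancelSMul.right_cancel _ _ (orbitClass H x).out
    (by rw [hx, mul_smul, orbitSection_smul_out])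

theorem card_eq_card_quotient_mul_card (H X : Type*) [Group H] [MulAction H X]
    [IsCancelSMul H X] : Nat.card X = Nat.card (orbitRel.Quotient H X) * Nat.card H := by
  rw [← Nat.card_prod]
  exact Nat.card_congr (selfEquivOrbitsQuotientProd IsCancelSMul.stabilizer_eq_bot)

/-- The equivariant bijection of free `H`-sets with a prescribed effect on orbits which matches
the orbit representatives. -/
noncomputable def freeActionEquiv (e : orbitRel.Quotient H A ≃ orbitRel.Quotient H B) : A ≃ B where
  toFun a := orbitSection H a • (e (orbitClass H a)).out
  invFun b := orbitSection H b • (e.symm (orbitClass H b)).out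
  left_inv a := by simp [orbitSection_smul]
  right_inv b := by simp [orbitSection_smul]

theorem freeActionEquiv_smul (e : orbitRel.Quotient H A ≃ orbitRel.Quotient H B) (h : H) (a : A) :
    freeActionEquiv e (h • a) = h • freeActionEquiv e a := by
  simp [freeActionEquiv, orbitSection_smul, mul_smul]

theorem exists_equivariant_equiv [Finite H] [Finite A] [Finite B]
    (hcard : Nat.card A = Nat.card B) :
    ∃ θ : A ≃ B, ∀ (h : H) (a : A), θ (h • a) = h • θ a := by
  rw [card_eq_card_quotient_mul_card H A, card_eq_card_quotient_mul_card H B] at hcard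
  obtain ⟨e⟩ := Finite.card_eq.1 (Nat.eq_of_mul_eq_mul_right Nat.card_pos hcard)
  exact ⟨freeActionEquiv e, freeActionEquiv_smul e⟩

theorem exists_conj_of_free {Q : Type*} [Finite H] [Finite Q] (ρ σ : H →* Equiv.Perm Q)
    (hρ : ∀ h q, ρ h q = q → h = 1) (hσ : ∀ h q, σ h q = q → h = 1) :
    ∃ s : Equiv.Perm Q, ∀ h, σ h * s = s * ρ h := by
  obtain ⟨θ, hθ⟩ := @exists_equivariant_equiv H Q Q _ (compHom Q ρ) (compHom Q σ)
    (@isCancelSMul_iff_eq_one_of_smul_eq H Q _ (compHom Q ρ) |>.2 hρ)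
    (@isCancelSMul_iff_eq_one_of_smul_eq H Q _ (compHom Q σ) |>.2 hσ) _ _ _ rfl
  exact ⟨θ, fun h => Equiv.ext fun q => (hθ h q).symm⟩

theorem IsCocycle.exists_cohomologous_of_free {d₁ d₂ : H → X → P} (h₁ : IsCocycle d₁)
    (h₂ : IsCocycle d₂) (ε : orbitRel.Quotient H X → P) :
    ∃ e : X → P, (∀ h x, e (h • x) * d₁ h x = d₂ h x * e x) ∧ ∀ ω, e ω.out = ε ω := by
  refine ⟨fun x => d₂ (orbitSection H x) (orbitClass H x).out * ε (orbitClass H x) *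
    (d₁ (orbitSection H x) (orbitClass H x).out)⁻¹, fun h x => ?_, fun ω => ?_⟩
  · simp only [orbitClass_smul, orbitSection_smul, h₁ h, h₂ h, orbitSection_smul_out]
    group
  · simp [h₁.one, h₂.one]

end FreeAction

section SpanningTree

/-- The edges `T` form a tree with vertex set `S` in the multigraph whose edge `e` joins `src e` to
`tgt e`. -/
inductive IsSubtree {V E : Type*} [DecidableEq V] [DecidableEq E] (src tgt : E → V) :
    Finset V → Finset E → Prop
  | vertex (v : V) : IsSubtree src tgt {v} ∅
  | grow {S : Finset V} {T : Finset E} {e : E} {v w : V} (h : IsSubtree src tgt S T)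
      (he : s(src e, tgt e) = s(v, w)) (hv : v ∈ S) (hw : w ∉ S) :
      IsSubtree src tgt (insert w S) (insert e T)

variable {V E : Type*} [DecidableEq V] [DecidableEq E] {src tgt : E → V} {S : Finset V}
  {T : Finset E}

namespace IsSubtree

theorem mem_of_mem_edge (h : IsSubtree src tgt S T) {e : E} (he : e ∈ T) {v : V}
    (hv : v ∈ s(src e, tgt e)) : v ∈ S := by
  induction h with
  | vertex => simp at he
  | grow h hjoin hmem _ ih =>
    rcases Finset.mem_insert.1 he with rfl | he
    · rw [hjoin, Sym2.mem_iff] at hv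
      rcases hv with rfl | rfl <;> simp [hmem]
    · exact Finset.mem_insert_of_mem (ih he)

theorem card_add_one (h : IsSubtree src tgt S T) : T.card + 1 = S.card := by
  induction h with
  | vertex => simp
  | @grow S T e v w h he _ hw ih =>
    have heT : e ∉ T := fun heT => hw (h.mem_of_mem_edge heT (he ▸ Sym2.mem_mk_right v w))
    rw [Finset.card_insert_of_notMem heT, Finset.card_insert_of_notMem hw, ih]

theorem exists_potential {Γ : Type*} [Group Γ] (h : IsSubtree src tgt S T) (l : E → Γ) :
    ∃ σ : V → Γ, ∀ e ∈ T, σ (tgt e) = l e * σ (src e) := by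
  induction h with
  | vertex => exact ⟨1, by simp⟩
  | @grow S T e v w h he hv hw ih =>
    obtain ⟨σ, hσ⟩ := ih
    have hvw : v ≠ w := fun hvw => hw (hvw ▸ hv)
    have hT (c : Γ) (e') (he' : e' ∈ T) : Function.update σ w c (tgt e') =
        l e' * Function.update σ w c (src e') := by
      have hne {u} (hu : u ∈ s(src e', tgt e')) : u ≠ w :=
        fun huw => hw (huw ▸ h.mem_of_mem_edge he' hu)
      simp [hne, hσ e' he']
    rcases Sym2.eq_iff.1 he with ⟨hs, ht⟩ | ⟨hs, ht⟩
    · exact ⟨_, Finset.forall_mem_insert _ _ _ |>.2 ⟨by simp [hs, ht, hvw], hT (l e * σ v)⟩⟩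
    · exact ⟨_, Finset.forall_mem_insert _ _ _ |>.2 ⟨by simp [hs, ht, hvw], hT ((l e)⁻¹ * σ v)⟩⟩

theorem mem_iff_mem (h : IsSubtree src tgt S T) {U : Set V}
    (hU : ∀ e ∈ T, src e ∈ U ↔ tgt e ∈ U) : ∀ v ∈ S, ∀ w ∈ S, v ∈ U ↔ w ∈ U := by
  induction h with
  | vertex => simp
  | @grow S T e v w _ he hv _ ih =>
    obtain ⟨heU, hTU⟩ := (Finset.forall_mem_insert _ _ _).1 hU
    have hvw : v ∈ U ↔ w ∈ U := by
      rcases Sym2.eq_iff.1 he with ⟨rfl, rfl⟩ | ⟨rfl, rfl⟩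
      exacts [heU, heU.symm]
    have hS (u) (hu : u ∈ insert w S) : u ∈ U ↔ v ∈ U := by
      rcases Finset.mem_insert.1 hu with rfl | hu
      exacts [hvw.symm, ih hTU u hu v hv]
    exact fun u hu u' hu' => (hS u hu).trans (hS u' hu').symm

theorem exists_spanning [Fintype V] [Nonempty V]
    (hconn : ∀ U : Set V, U.Nonempty → (∀ e, src e ∈ U ↔ tgt e ∈ U) → U = Set.univ) :
    ∃ T, IsSubtree src tgt Finset.univ T := by
  obtain ⟨S, ⟨T, hT⟩, hmax⟩ := (Set.toFinite {S | ∃ T, IsSubtree src tgt S T}).exists_maximal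
    ⟨_, _, .vertex (Classical.arbitrary V)⟩
  have hclosed {e v w} (he : s(src e, tgt e) = s(v, w)) (hv : v ∈ S) : w ∈ S := by
    by_contra hw
    exact hw (hmax ⟨_, hT.grow he hv hw⟩ (Finset.subset_insert _ _) (Finset.mem_insert_self _ _))
  have hS : S.Nonempty := Finset.card_pos.1 (hT.card_add_one ▸ Nat.succ_pos _)
  have huniv := hconn S hS fun e => ⟨hclosed rfl, hclosed Sym2.eq_swap⟩
  exact ⟨T, Finset.coe_eq_univ.1 huniv ▸ hT⟩

end IsSubtree

end SpanningTree

section OneEdgeSplitting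

variable {I : Type} {G : I → Type u} [∀ i, Group (G i)] {H Γ : Type u} [Group H] [Group Γ]
  {a b : I}

/-- `Γ` is the fundamental group, in the sense of Serre, of a graph of groups with a single edge:
vertex groups `G i`, edge group `H`, and stable letter `t`, which is killed if the edge is not a
loop. Thus `Γ` is an HNN extension if `a = b` and an amalgamated product if `a ≠ b`. The universal
property is only required for groups in the universe of `Γ`. -/
structure IsOneEdgeSplitting (α : H →* G a) (β : H →* G b) (j : ∀ i, G i →* Γ) (t : Γ) : Prop where
  eq_or_eq : ∀ i, i = a ∨ i = b
  edge_rel : ∀ h, j b (β h) * t = t * j a (α h)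
  eq_one_of_ne : a ≠ b → t = 1
  eq_top : ∀ S : Subgroup Γ, (∀ i g, j i g ∈ S) → t ∈ S → S = ⊤
  exists_lift : ∀ (M : Type u) [Group M] (f : ∀ i, G i →* M) (s : M),
    (∀ h, f b (β h) * s = s * f a (α h)) → (a ≠ b → s = 1) →
      ∃ F : Γ →* M, (∀ i g, F (j i g) = f i g) ∧ F t = s

/-- An action of `Γ` on `E` glued from actions `f i` of the vertex groups along the edge map `s`.
As the stable letter of an amalgamated product is `1`, each vertex group acts through `f i` only
after a change of coordinates `chart i`. -/
structure GluedAction {E : Type*} (a b : I) (j : ∀ i, G i →* Γ) (t : Γ)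
    (f : ∀ i, G i →* Equiv.Perm E) (s : Equiv.Perm E) where
  /-- The glued action. -/
  toHom : Γ →* Equiv.Perm E
  /-- The coordinates in which `G i` acts through `f i`. -/
  chart : I → Equiv.Perm E
  chart_base : chart a = 1
  toHom_vertex : ∀ i g, toHom (j i g) = chart i * f i g * (chart i)⁻¹
  toHom_edge : toHom t = chart b * s

variable {α : H →* G a} {β : H →* G b} {j : ∀ i, G i →* Γ} {t : Γ}

theorem IsOneEdgeSplitting.nonempty_gluedAction (hΓ : IsOneEdgeSplitting α β j t) {E : Type u}
    {f : ∀ i, G i →* Equiv.Perm E} {s : Equiv.Perm E}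
    (hs : ∀ h, f b (β h) * s = s * f a (α h)) : Nonempty (GluedAction a b j t f s) := by
  classical
  let c : I → Equiv.Perm E := fun i => if i = a then 1 else s⁻¹
  have hca : c a = 1 := if_pos rfl
  obtain ⟨F, hF, hFt⟩ := hΓ.exists_lift _ (fun i => (MulAut.conj (c i)).toMonoidHom.comp (f i))
    (c b * s) (fun h => by simp [hca, mul_assoc, hs]) (fun hab => by simp [c, hab.symm])
  exact ⟨⟨F, c, hca, hF, hFt⟩⟩

namespace GluedAction

variable {E B : Type*} {f : ∀ i, G i →* Equiv.Perm E} {s : Equiv.Perm E}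
  {ρ : Γ →* Equiv.Perm B} {κ : I → E → B}

theorem apply_chart (A : GluedAction a b j t f s) (hΓ : IsOneEdgeSplitting α β j t)
    (hκt : ∀ z, κ b (s z) = ρ t (κ a z)) (i : I) (z : E) : κ a (A.chart i z) = κ i z := by
  by_cases hia : i = a
  · rw [hia, A.chart_base, Equiv.Perm.one_apply]
  obtain rfl := (hΓ.eq_or_eq i).resolve_left hia
  have ht := hΓ.eq_one_of_ne (Ne.symm hia)
  have hchart : A.chart i * s = 1 :=
    A.toHom_edge.symm.trans ((congrArg A.toHom ht).trans (map_one _))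
  rw [eq_inv_of_mul_eq_one_left hchart]
  simpa [ht] using (hκt (s⁻¹ z)).symm

theorem apply_toHom (A : GluedAction a b j t f s) (hΓ : IsOneEdgeSplitting α β j t)
    (hκ : ∀ i g z, κ i (f i g z) = ρ (j i g) (κ i z)) (hκt : ∀ z, κ b (s z) = ρ t (κ a z))
    (γ : Γ) (z : E) : κ a (A.toHom γ z) = ρ γ (κ a z) := by
  let S : Subgroup Γ :=
    { carrier := {γ | ∀ z, κ a (A.toHom γ z) = ρ γ (κ a z)}
      one_mem' := by simp
      mul_mem' := fun hγ hδ z => by simp [hγ _, hδ _]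
      inv_mem' := fun {γ} hγ z => by
        rw [map_inv, map_inv, Equiv.Perm.eq_inv_iff_eq, ← hγ, ← Equiv.Perm.mul_apply,
            mul_inv_cancel, Equiv.Perm.one_apply] }
  have hS : S = ⊤ := by
    refine hΓ.eq_top S (fun i g z => ?_) fun z => ?_
    · obtain ⟨z, rfl⟩ := (A.chart i).surjective z
      simp [A.toHom_vertex, A.apply_chart hΓ hκt, hκ]
    · simp [A.toHom_edge, A.apply_chart hΓ hκt, hκt]
  exact (hS ▸ Subgroup.mem_top γ : γ ∈ S) z

end GluedAction

variable {X : Type u} [MulAction Γ X] [∀ i, MulAction (G i) X]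

theorem IsOneEdgeSplitting.smul_smul_eq (hΓ : IsOneEdgeSplitting α β j t)
    (hj : ∀ i (g : G i) (x : X), j i g • x = g • x) (h : H) (x : X) :
    β h • t • x = t • α h • x := by
  rw [← hj, ← hj, ← mul_smul, ← mul_smul, hΓ.edge_rel]

/-- The group `Γ` acts on `X × P` by the glued twisted actions. As `(x, p) ↦ τ a x * Ψ p` is an
equivariant map to `Γ`, this action is free; by `hconn` it is transitive. -/
theorem IsOneEdgeSplitting.nonempty_stabilizer_mulEquiv_of_isCocycle {P : Type u} [Group P]
    (hΓ : IsOneEdgeSplitting α β j t) (hj : ∀ i (g : G i) (x : X), j i g • x = g • x)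
    {d : ∀ i, G i → X → P} (hd : ∀ i, IsCocycle (d i)) {e : X → P}
    (he : ∀ h x, d b (β h) (t • x) * e x = e (α h • x) * d a (α h) x)
    {Ψ : P →* Γ} {τ : I → X → Γ}
    (hτ : ∀ i g x, Ψ (d i g x) = (τ i (g • x))⁻¹ * j i g * τ i x)
    (hτt : ∀ x, Ψ (e x) = (τ b (t • x))⁻¹ * t * τ a x) {x₀ : X}
    (hconn : ∀ O : I → Set (X × P), (∀ i g z, skewHom (hd i) g z ∈ O i ↔ z ∈ O i) →
      (∀ z, skewPerm (toPerm t) e z ∈ O b ↔ z ∈ O a) → (x₀, 1) ∈ O a →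
        O a = Set.univ) :
    Nonempty (stabilizer Γ x₀ ≃* P) := by
  obtain ⟨A⟩ := hΓ.nonempty_gluedAction (f := fun i => skewHom (hd i))
    (s := skewPerm (toPerm t) e) fun h => Equiv.ext fun z => by
      ext <;> simp [hΓ.smul_smul_eq hj, ← mul_assoc, he]
  have hvertex (i g z) : A.chart i (skewHom (hd i) g z) = A.toHom (j i g) (A.chart i z) := by
    simp [A.toHom_vertex]
  have hedge (z) : A.chart b (skewPerm (toPerm t) e z) = A.toHom t (A.chart a z) := by
    simp [A.toHom_edge, A.chart_base]
  have horbit (γ : Γ) (z w) : (∃ δ, A.toHom δ z = A.toHom γ w) ↔ ∃ δ, A.toHom δ z = w :=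
    (Equiv.mulLeft γ⁻¹).exists_congr fun δ => by
      simp only [Equiv.coe_mulLeft, map_mul, map_inv, Equiv.Perm.mul_apply,
        Equiv.Perm.inv_eq_iff_eq]
  refine nonempty_stabilizer_mulEquiv_of_torsor A.toHom x₀ ?_ (fun γ x p q => ?_)
    (fun γ z hz => ?_) fun z => ?_
  · exact A.apply_toHom hΓ (ρ := toPermHom Γ X) (κ := fun _ => Prod.fst)
      (fun i g z => (hj i g z.1).symm) fun z => rfl
  · have key := A.apply_toHom hΓ (ρ := A.toHom) (κ := fun i z => A.chart i (z.1, z.2 * q))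
      (fun i g z => by rw [← hvertex]; simp [mul_assoc])
      (fun z => by rw [← hedge]; simp [mul_assoc]) γ (x, p)
    simpa [A.chart_base] using key.symm
  · have key := A.apply_toHom hΓ (ρ := toPermHom Γ Γ) (κ := fun i z => τ i z.1 * Ψ z.2)
      (fun i g z => by simp [hτ, mul_assoc]) (fun z => by simp [hτt, mul_assoc]) γ z
    rw [hz] at key
    exact mul_eq_right.1 key.symm
  · have huniv := hconn (fun i => {z | ∃ γ, A.toHom γ (x₀, 1) = A.chart i z})
      (fun i g z => ?_) (fun z => ?_) ⟨1, by simp [A.chart_base]⟩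
    · simpa [A.chart_base] using (huniv ▸ Set.mem_univ z :)
    · simp only [Set.mem_ofPred_eq, hvertex, horbit]
    · simp only [Set.mem_ofPred_eq, hedge, horbit]

end OneEdgeSplitting

section KuroshDecomposition

variable {I : Type} {G : I → Type u} [∀ i, Group (G i)] {H Γ : Type u} [Group H] [Group Γ]
  {a b : I} {α : H →* G a} {β : H →* G b} {j : ∀ i, G i →* Γ} {t : Γ} {X : Type u}
  [MulAction Γ X] [∀ i, MulAction (G i) X] [MulAction H X]

variable (G X) in
/-- The vertices of the graph of orbits, which is the covering of the one-edge graph of groups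
belonging to the `Γ`-set `X`: the orbits of the vertex groups. Its edges are the orbits of `H`. -/
abbrev OrbitVertex : Type u :=
  Σ i, orbitRel.Quotient (G i) X

variable (G a) in
/-- The source of an edge of the graph of orbits. -/
noncomputable def edgeSource (ω : orbitRel.Quotient H X) : OrbitVertex G X :=
  ⟨a, orbitClass (G a) ω.out⟩

variable (G b t) in
/-- The target of an edge of the graph of orbits. -/
noncomputable def edgeTarget (ω : orbitRel.Quotient H X) : OrbitVertex G X :=
  ⟨b, orbitClass (G b) (t • ω.out)⟩

/-- An action of `Γ` itself, viewed as glued from its restrictions to the vertex groups. -/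
def GluedAction.ofMulAction (hj : ∀ i (g : G i) (x : X), j i g • x = g • x) :
    GluedAction a b j t (fun i => toPermHom (G i) X) (toPerm t) where
  toHom := toPermHom Γ X
  chart := 1
  chart_base := rfl
  toHom_vertex i g := by ext x; simp [hj]
  toHom_edge := rfl

theorem IsOneEdgeSplitting.orbitGraph_connected (hΓ : IsOneEdgeSplitting α β j t)
    (hj : ∀ i (g : G i) (x : X), j i g • x = g • x) (hα : ∀ (h : H) (x : X), α h • x = h • x)
    [IsPretransitive Γ X] {U : Set (OrbitVertex G X)} (hU : U.Nonempty)
    (hedge : ∀ ω : orbitRel.Quotient H X, edgeSource G a ω ∈ U ↔ edgeTarget G b t ω ∈ U) :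
    U = Set.univ := by
  let κ (i : I) (x : X) : Prop := ⟨i, orbitClass (G i) x⟩ ∈ U
  have hκ (i) (g : G i) (x) : κ i (g • x) = κ i x := by simp only [κ, orbitClass_smul]
  have hκt (x : X) : κ b (t • x) = κ a x := by
    obtain ⟨h, y, rfl, hy⟩ : ∃ (h : H) (y : X), h • y = x ∧ κ b (t • y) = κ a y :=
      ⟨orbitSection H x, _, orbitSection_smul_out x, propext (hedge _).symm⟩
    rw [← hα, ← hΓ.smul_smul_eq hj, hκ, hκ, hy]
  let A := GluedAction.ofMulAction (a := a) (b := b) (t := t) hj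
  have hA (γ : Γ) (x : X) : κ a (γ • x) = κ a x :=
    A.apply_toHom hΓ (ρ := 1) (κ := κ) hκ hκt γ x
  have hchart (i : I) (x : X) : κ a x = κ i x := A.apply_chart hΓ (ρ := 1) hκt i x
  obtain ⟨⟨i, v⟩, hv⟩ := hU
  refine Set.eq_univ_of_forall fun ⟨k, w⟩ => ?_
  obtain ⟨γ, hγ⟩ := exists_smul_eq Γ v.out w.out
  rw [← orbitClass_out v] at hv
  rw [← orbitClass_out w]
  change κ k w.out
  rwa [← hchart, ← hγ, hA, hchart i]

variable (G) in
/-- The free product of the stabilizers of the orbit representatives of the vertex groups and of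
the free group on the edges outside `T`; if `T` is a spanning tree, this is the fundamental group of
the graph of orbits, as `H` acts freely. -/
abbrev KuroshGroup (T : Finset (orbitRel.Quotient H X)) : Type u :=
  Coprod (CoprodI fun v : OrbitVertex G X => stabilizer (G v.1) v.2.out)
    (FreeGroup {ω : orbitRel.Quotient H X // ω ∉ T})

variable (T : Finset (orbitRel.Quotient H X))

namespace KuroshGroup

/-- The inclusion of the stabilizer of an orbit representative. -/
noncomputable def ofVertex (i : I) (v : orbitRel.Quotient (G i) X) :
    stabilizer (G i) v.out →* KuroshGroup G T :=
  Coprod.inl.comp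
    (CoprodI.of (M := fun v : OrbitVertex G X => stabilizer (G v.1) v.2.out) (i := ⟨i, v⟩))

open Classical in
/-- The generator belonging to an edge; it is trivial on `T`. -/
noncomputable def ofEdge (ω : orbitRel.Quotient H X) : KuroshGroup G T :=
  if hω : ω ∈ T then 1 else Coprod.inr (FreeGroup.of ⟨ω, hω⟩)

theorem ofEdge_of_mem {T : Finset (orbitRel.Quotient H X)} {ω} (hω : ω ∈ T) :
    ofEdge (G := G) T ω = 1 :=
  dif_pos hω

theorem eq_top_of_generators_mem {S : Subgroup (KuroshGroup G T)}
    (hvertex : ∀ i v g, ofVertex T i v g ∈ S) (hedge : ∀ ω, ofEdge T ω ∈ S) : S = ⊤ := by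
  rw [eq_top_iff, ← Coprod.range_inl_sup_range_inr, sup_le_iff, MonoidHom.range_eq_map,
    MonoidHom.range_eq_map, Subgroup.map_le_iff_le_comap, Subgroup.map_le_iff_le_comap]
  constructor
  · intro x _
    induction x using CoprodI.induction_on with
    | one => exact one_mem _
    | of v g => exact hvertex v.1 v.2 g
    | mul x y hx hy => exact mul_mem (hx trivial) (hy trivial)
  · rw [← FreeGroup.closure_range_of, Subgroup.closure_le]
    rintro _ ⟨ω, rfl⟩
    simpa [ofEdge, ω.2] using hedge ω.1

theorem exists_hom {M : Type*} [Group M]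
    (f : ∀ i (v : orbitRel.Quotient (G i) X), stabilizer (G i) v.out →* M)
    {c : orbitRel.Quotient H X → M} (hc : ∀ ω ∈ T, c ω = 1) :
    ∃ Ψ : KuroshGroup G T →* M, (∀ i v g, Ψ (ofVertex T i v g) = f i v g) ∧
      ∀ ω, Ψ (ofEdge T ω) = c ω := by
  refine ⟨Coprod.lift (CoprodI.lift fun v => f v.1 v.2) (FreeGroup.lift fun ω => c ω.1),
    fun i v g => by simp [ofVertex], fun ω => ?_⟩
  by_cases hω : ω ∈ T
  · rw [ofEdge_of_mem hω, map_one, hc ω hω]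
  · simp [ofEdge, hω]

/-- The cocycle which twists the action of `G i` on `X × KuroshGroup G T`. -/
noncomputable def cocycle (i : I) : G i → X → KuroshGroup G T :=
  orbitCocycle (ofVertex T i)

theorem isCocycle_cocycle (i : I) : IsCocycle (cocycle (G := G) T i) :=
  isCocycle_orbitCocycle _

theorem exists_edgeCocycle [IsCancelSMul H X] (hΓ : IsOneEdgeSplitting α β j t)
    (hj : ∀ i (g : G i) (x : X), j i g • x = g • x) (hα : ∀ (h : H) (x : X), α h • x = h • x) :
    ∃ e : X → KuroshGroup G T, (∀ h x, cocycle T b (β h) (t • x) * e x =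
      e (α h • x) * cocycle T a (α h) x) ∧ ∀ ω : orbitRel.Quotient H X, e ω.out = ofEdge T ω := by
  obtain ⟨e, he, heω⟩ := IsCocycle.exists_cohomologous_of_free (H := H)
    (d₁ := fun h x => cocycle T a (α h) x) (d₂ := fun h x => cocycle T b (β h) (t • x))
    (fun g h x => by simp only [map_mul, isCocycle_cocycle T a _ _ x, hα])
    (fun g h x => by
      simp only [map_mul, isCocycle_cocycle T b _ _ (t • x), hΓ.smul_smul_eq hj, hα])
    (ofEdge T)
  exact ⟨e, fun h x => by rw [hα, he], heω⟩

variable {T}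

theorem exists_trivializing_hom [DecidableEq (OrbitVertex G X)]
    [DecidableEq (orbitRel.Quotient H X)]
    (hΓ : IsOneEdgeSplitting α β j t) (hα : ∀ (h : H) (x : X), α h • x = h • x)
    (hj : ∀ i (g : G i) (x : X), j i g • x = g • x) {S : Finset (OrbitVertex G X)}
    (hT : IsSubtree (edgeSource G a) (edgeTarget G b t) S T) {e : X → KuroshGroup G T}
    (he : ∀ h x, cocycle T b (β h) (t • x) * e x = e (α h • x) * cocycle T a (α h) x)
    (heω : ∀ ω : orbitRel.Quotient H X, e ω.out = ofEdge T ω) :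
    ∃ (Ψ : KuroshGroup G T →* Γ) (τ : I → X → Γ),
      (∀ i g x, Ψ (cocycle T i g x) = (τ i (g • x))⁻¹ * j i g * τ i x) ∧
        ∀ x, Ψ (e x) = (τ b (t • x))⁻¹ * t * τ a x := by
  obtain ⟨σ, hσ⟩ := hT.exists_potential fun ω =>
    (j b (orbitSection (G b) (t • ω.out)))⁻¹ * t * j a (orbitSection (G a) ω.out)
  let τ (i : I) (x : X) : Γ := j i (orbitSection (G i) x) * σ ⟨i, orbitClass (G i) x⟩
  obtain ⟨Ψ, hΨ, hΨω⟩ := exists_hom T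
    (fun i v => (MulAut.conj (σ ⟨i, v⟩)⁻¹).toMonoidHom.comp
      ((j i).comp (stabilizer _ v.out).subtype))
    (c := fun ω => (τ b (t • ω.out))⁻¹ * t * τ a ω.out) fun ω hω => by
      have hσω := hσ ω hω
      simp only [edgeSource, edgeTarget] at hσω
      simp only [τ, hσω]
      group
  have hτ (i g x) : Ψ (cocycle T i g x) = (τ i (g • x))⁻¹ * j i g * τ i x :=
    map_orbitCocycle _ Ψ (j i) (fun v => σ ⟨i, v⟩) (fun v g => by simp [hΨ]) g x
  refine ⟨Ψ, τ, hτ, fun x => ?_⟩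
  obtain ⟨h, y, rfl, hy⟩ : ∃ (h : H) (y : X), α h • y = x ∧
      Ψ (e y) = (τ b (t • y))⁻¹ * t * τ a y :=
    ⟨orbitSection H x, _, (hα _ _).trans (orbitSection_smul_out x), by rw [heω, hΨω]⟩
  have key := congrArg Ψ (he h y)
  rw [map_mul, map_mul, hτ, hτ, hy, hΓ.smul_smul_eq hj] at key
  refine mul_right_cancel (key.symm.trans ?_)
  calc _ = (τ b (t • α h • y))⁻¹ * (j b (β h) * t) * τ a y := by group
    _ = _ := by rw [hΓ.edge_rel]; group

open scoped Pointwise in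
theorem eq_univ_of_invariant [DecidableEq (OrbitVertex G X)] [Fintype (OrbitVertex G X)]
    [DecidableEq (orbitRel.Quotient H X)]
    (hT : IsSubtree (edgeSource G a) (edgeTarget G b t) Finset.univ T)
    {e : X → KuroshGroup G T} (heω : ∀ ω : orbitRel.Quotient H X, e ω.out = ofEdge T ω)
    {O : I → Set (X × KuroshGroup G T)}
    (hO : ∀ i g z, skewHom (isCocycle_cocycle T i) g z ∈ O i ↔ z ∈ O i)
    (hOt : ∀ z, skewPerm (toPerm t) e z ∈ O b ↔ z ∈ O a) {x₀ : X}
    (hx₀ : (x₀, 1) ∈ O a) : O a = Set.univ := by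
  have hrep (i x p) : (x, p) ∈ O i ↔ ((orbitClass (G i) x).out, p) ∈ O i := by
    have := hO i (orbitSection (G i) x) ((orbitClass (G i) x).out, p)
    rwa [skewHom_apply, skewPerm_apply, toPerm_apply, orbitSection_smul_out, cocycle,
      orbitCocycle_orbitSection, one_mul] at this
  have hfib {p} {v w : OrbitVertex G X} : (v.2.out, p) ∈ O v.1 ↔ (w.2.out, p) ∈ O w.1 :=
    hT.mem_iff_mem (U := {v : OrbitVertex G X | (v.2.out, p) ∈ O v.1}) (fun ω hω => by
      have := hOt (ω.out, p)
      rw [skewPerm_apply, heω, ofEdge_of_mem hω, one_mul] at this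
      exact (hrep a _ p).symm.trans (this.symm.trans (hrep b _ p)))
      v (Finset.mem_univ v) w (Finset.mem_univ w)
  have hconst {p i x k y} : (x, p) ∈ O i ↔ (y, p) ∈ O k :=
    (hrep i x p).trans ((hfib (v := ⟨i, _⟩) (w := ⟨k, _⟩)).trans (hrep k y p).symm)
  -- The fibres of `O` all agree, so left translation by each generator preserves them.
  let Q : Set (KuroshGroup G T) := {p | (x₀, p) ∈ O a}
  have hQ : stabilizer (KuroshGroup G T) Q = ⊤ :=
    eq_top_of_generators_mem T (fun i v g => mem_stabilizer_set.2 fun p => ?_)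
      fun ω => mem_stabilizer_set.2 fun p => ?_
  · refine Set.eq_univ_of_forall fun ⟨x, p⟩ => ?_
    have hp : p ∈ stabilizer (KuroshGroup G T) Q := hQ ▸ Subgroup.mem_top p
    have := (mem_stabilizer_set.1 hp 1).2 hx₀
    rw [smul_eq_mul, mul_one] at this
    exact hconst.1 this
  · have := hO i g (v.out, p)
    simp only [skewHom_apply, skewPerm_apply, cocycle, orbitCocycle_stabilizer] at this
    exact hconst.trans (this.trans hconst)
  · have := hOt (ω.out, p)
    rw [skewPerm_apply, heω] at this
    exact hconst.trans (this.trans hconst)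

end KuroshGroup

theorem IsOneEdgeSplitting.exists_stabilizer_mulEquiv_kuroshGroup [Finite I] [Finite X]
    [IsPretransitive Γ X] [IsCancelSMul H X] (hΓ : IsOneEdgeSplitting α β j t)
    (hj : ∀ i (g : G i) (x : X), j i g • x = g • x) (hα : ∀ (h : H) (x : X), α h • x = h • x)
    (x₀ : X) :
    ∃ T : Finset (orbitRel.Quotient H X), T.card + 1 = Nat.card (OrbitVertex G X) ∧
      Nonempty (stabilizer Γ x₀ ≃* KuroshGroup G T) := by
  classical
  have := Fintype.ofFinite (OrbitVertex G X)
  have : Nonempty (OrbitVertex G X) := ⟨⟨a, orbitClass (G a) x₀⟩⟩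
  obtain ⟨T, hT⟩ := IsSubtree.exists_spanning fun _ => hΓ.orbitGraph_connected hj hα
  refine ⟨T, by rw [hT.card_add_one, Finset.card_univ, Nat.card_eq_fintype_card], ?_⟩
  obtain ⟨e, he, heω⟩ := KuroshGroup.exists_edgeCocycle T hΓ hj hα
  obtain ⟨Ψ, τ, hτ, hτt⟩ := KuroshGroup.exists_trivializing_hom hΓ hα hj hT he heω
  exact hΓ.nonempty_stabilizer_mulEquiv_of_isCocycle hj (KuroshGroup.isCocycle_cocycle T) he
    hτ hτt fun O hO hOt => KuroshGroup.eq_univ_of_invariant hT heω hO hOt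

end KuroshDecomposition

section EulerCharacteristic

variable {I : Type} {G : I → Type u} [∀ i, Group (G i)] {H Γ : Type u} [Group H] [Group Γ]
  {a b : I} {α : H →* G a} {β : H →* G b} {j : ∀ i, G i →* Γ} {t : Γ}
  {C : (G : Type u) → [Group G] → Prop} {χ : (G : Type u) → [Group G] → ℝ}

theorem IsFreelyAdditive.hasEuler_kuroshGroup (h : IsFreelyAdditive C χ) [Fintype I]
    (hG : ∀ i, C (G i)) {X : Type u} [Finite X] [∀ i, MulAction (G i) X] [MulAction H X]
    [Nonempty (OrbitVertex G X)] (T : Finset (orbitRel.Quotient H X)) :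
    HasEuler C χ (KuroshGroup G T) (Nat.card X * ∑ i, χ (G i) - Nat.card (OrbitVertex G X) + 1
      + T.card - Nat.card (orbitRel.Quotient H X)) := by
  have (i : I) := Fintype.ofFinite (orbitRel.Quotient (G i) X)
  have := Fintype.ofFinite (orbitRel.Quotient H X)
  have hstab (v : OrbitVertex G X) : (stabilizer (G v.1) v.2.out).FiniteIndex :=
    finiteIndex_stabilizer _
  have key := h.hasEuler_coprod_freeGroup
    (h.hasEuler_coprodI fun v : OrbitVertex G X =>
      h.hasEuler_subgroup (hG v.1) (stabilizer _ v.2.out))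
    {ω : orbitRel.Quotient H X // ω ∉ T}
  have hsum : ∑ v : OrbitVertex G X, ((stabilizer (G v.1) v.2.out).index : ℝ) * χ (G v.1) =
      Nat.card X * ∑ i, χ (G i) := by
    rw [Fintype.sum_sigma, Finset.mul_sum]
    exact Finset.sum_congr rfl fun i _ => by
      rw [← sum_index_stabilizer (G := G i), Nat.cast_sum, Finset.sum_mul]
  have hcard : (Nat.card {ω : orbitRel.Quotient H X // ω ∉ T} : ℝ) =
      Nat.card (orbitRel.Quotient H X) - T.card := by
    classical
    rw [Nat.card_eq_fintype_card, Fintype.card_subtype_compl, Fintype.card_coe,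
      Nat.cast_sub (Finset.card_le_univ T), Nat.card_eq_fintype_card]
  convert key using 1
  rw [hcard, Finset.sum_sub_distrib, hsum]
  simp only [Finset.sum_const, Finset.card_univ, nsmul_eq_mul, mul_one, Nat.card_eq_fintype_card]
  ring

theorem IsFreelyAdditive.wallExtension_of_transitive_of_free (h : IsFreelyAdditive C χ) [Fintype I]
    [Finite H] (hΓ : IsOneEdgeSplitting α β j t) (hG : ∀ i, C (G i)) {X : Type u} [Finite X]
    [MulAction Γ X] [IsPretransitive Γ X] [∀ i, MulAction (G i) X] [MulAction H X]
    [IsCancelSMul H X] (x₀ : X) (hj : ∀ i (g : G i) (x : X), j i g • x = g • x)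
    (hα : ∀ (h : H) (x : X), α h • x = h • x) :
    VirtuallyIn C Γ ∧ wallExtension C χ Γ = ∑ i, χ (G i) - 1 / Nat.card H := by
  have : Nonempty X := ⟨x₀⟩
  have : Nonempty (OrbitVertex G X) := ⟨⟨a, orbitClass (G a) x₀⟩⟩
  obtain ⟨T, hT, ⟨e⟩⟩ := hΓ.exists_stabilizer_mulEquiv_kuroshGroup hj hα x₀
  obtain ⟨hvirt, hwall⟩ := h.wallExtension_of_transitive (h.hasEuler_kuroshGroup hG T) e
  refine ⟨hvirt, hwall.trans ?_⟩
  have hX : (Nat.card X : ℝ) = Nat.card (orbitRel.Quotient H X) * Nat.card H :=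
    mod_cast card_eq_card_quotient_mul_card H X
  have hH : (Nat.card H : ℝ) ≠ 0 := Nat.cast_ne_zero.2 Nat.card_pos.ne'
  have hX₀ : (Nat.card X : ℝ) ≠ 0 := Nat.cast_ne_zero.2 Nat.card_pos.ne'
  rw [← hT, div_eq_iff hX₀, sub_mul, one_div, inv_mul_eq_div, (div_eq_iff hH).2 hX]
  push_cast
  ring

theorem exists_normal_finiteIndex_inter {G : Type*} [Group G]
    (hG : Group.ResiduallyFinite G ∨ VirtuallyTorsionFree G) {S : Set G} (hS : S.Finite)
    (hfin : ∀ s ∈ S, IsOfFinOrder s) :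
    ∃ N : Subgroup G, N.Normal ∧ N.FiniteIndex ∧ ∀ s ∈ S, s ∈ N → s = 1 := by
  rcases hG with hG | ⟨K, hK, hKt⟩
  · have hsep (s : S) : ∃ N : Subgroup G, N.Normal ∧ N.FiniteIndex ∧ (s.1 ∈ N → s.1 = 1) := by
      by_cases hs : s.1 = 1
      · exact ⟨⊤, inferInstance, inferInstance, fun _ => hs⟩
      · obtain ⟨N, hN⟩ := Group.exists_finiteIndexNormalSubgroup_notMem s.1 hs
        exact ⟨N.toSubgroup, inferInstance, inferInstance, fun h => absurd h hN⟩
    choose N hN hNf hNs using hsep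
    have := hS.to_subtype
    exact ⟨⨅ s, N s, Subgroup.normal_iInf_normal hN, Subgroup.finiteIndex_iInf hNf,
      fun s hs h => hNs ⟨s, hs⟩ (Subgroup.mem_iInf.1 h _)⟩
  · exact ⟨K.normalCore, inferInstance, inferInstance,
      fun s hs h => hKt s (K.normalCore_le h) (hfin s hs)⟩

theorem exists_normal_finiteIndex_edge_inter [Finite H] (α : H →* G a) (β : H →* G b)
    (hG : ∀ i, Group.ResiduallyFinite (G i) ∨ VirtuallyTorsionFree (G i)) :
    ∃ N : ∀ i, Subgroup (G i), (∀ i, (N i).Normal) ∧ (∀ i, (N i).FiniteIndex) ∧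
      (∀ h, α h ∈ N a → α h = 1) ∧ ∀ h, β h ∈ N b → β h = 1 := by
  let S : Set (Σ i, G i) := Set.range (fun h => ⟨a, α h⟩) ∪ Set.range (fun h => ⟨b, β h⟩)
  have hS : S.Finite := (Set.finite_range _).union (Set.finite_range _)
  have htorsion (i : I) : ∀ g ∈ Sigma.mk i ⁻¹' S, IsOfFinOrder g := by
    rintro g (⟨h, hg⟩ | ⟨h, hg⟩) <;> cases hg <;>
      exact MonoidHom.isOfFinOrder _ (isOfFinOrder_of_finite h)
  choose N hN hNf hNS using fun i => exists_normal_finiteIndex_inter (hG i)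
    (hS.preimage sigma_mk_injective.injOn) (htorsion i)
  exact ⟨N, hN, hNf, fun h => hNS a _ (.inl ⟨h, rfl⟩), fun h => hNS b _ (.inr ⟨h, rfl⟩)⟩

theorem IsOneEdgeSplitting.exists_finite_action [Finite I] [Finite H]
    (hΓ : IsOneEdgeSplitting α β j t) (hα : Function.Injective α) (hβ : Function.Injective β)
    (hG : ∀ i, Group.ResiduallyFinite (G i) ∨ VirtuallyTorsionFree (G i)) :
    ∃ (Q : Type u) (_ : Finite Q) (_ : Nonempty Q) (F : Γ →* Equiv.Perm Q),
      ∀ h q, F (j a (α h)) q = q → h = 1 := by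
  classical
  obtain ⟨N, hN, hNf, hNα, hNβ⟩ := exists_normal_finiteIndex_edge_inter α β hG
  let Q := ∀ i, G i ⧸ N i
  let f (i : I) : G i →* Equiv.Perm Q := (toPermHom Q Q).comp
    ((MonoidHom.mulSingle (fun i => G i ⧸ N i) i).comp (QuotientGroup.mk' (N i)))
  have hf (i g q) (hq : f i g q = q) : g ∈ N i := by
    have hg : Pi.mulSingle i (g : G i ⧸ N i) = (1 : Q) := mul_eq_right.1 hq
    rwa [Pi.mulSingle_eq_one_iff, QuotientGroup.eq_one_iff] at hg
  have hfα (h q) (hq : f a (α h) q = q) : h = 1 :=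
    (map_eq_one_iff α hα).1 (hNα h (hf a _ q hq))
  obtain ⟨s, hs⟩ := exists_conj_of_free ((f a).comp α) ((f b).comp β) hfα
    fun h q hq => (map_eq_one_iff β hβ).1 (hNβ h (hf b _ q hq))
  obtain ⟨A⟩ := hΓ.nonempty_gluedAction (f := f) hs
  refine ⟨Q, inferInstance, inferInstance, A.toHom, fun h q hq => hfα h q ?_⟩
  simpa [A.toHom_vertex, A.chart_base] using hq

theorem IsFreelyAdditive.wallExtension_oneEdgeSplitting (h : IsFreelyAdditive C χ) [Fintype I]
    [Finite H] (hΓ : IsOneEdgeSplitting α β j t) (hα : Function.Injective α)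
    (hβ : Function.Injective β) (hG : ∀ i, C (G i))
    (hG' : ∀ i, Group.ResiduallyFinite (G i) ∨ VirtuallyTorsionFree (G i)) :
    VirtuallyIn C Γ ∧ wallExtension C χ Γ = ∑ i, χ (G i) - 1 / Nat.card H := by
  obtain ⟨Q, _, ⟨q⟩, F, hF⟩ := hΓ.exists_finite_action hα hβ hG'
  let _ : MulAction Γ Q := compHom Q F
  let _ (i : I) : MulAction (G i) (orbit Γ q) := compHom _ (j i)
  let _ : MulAction H (orbit Γ q) := compHom _ ((j a).comp α)
  have : IsCancelSMul H (orbit Γ q) := isCancelSMul_iff_eq_one_of_smul_eq.2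
    fun h x hx => hF h x (congrArg Subtype.val hx)
  exact h.wallExtension_of_transitive_of_free hΓ hG (⟨q, mem_orbit_self q⟩ : orbit Γ q)
    (fun _ _ _ => rfl) fun _ _ => rfl

end EulerCharacteristic

theorem isOneEdgeSplitting_hnnExtension {G : Type u} [Group G] {H H' : Subgroup G} (φ : H ≃* H') :
    IsOneEdgeSplitting (I := Unit) (G := fun _ => G) (a := ()) (b := ()) H.subtype
      (H'.subtype.comp φ.toMonoidHom) (fun _ => HNNExtension.of (φ := φ)) HNNExtension.t where
  eq_or_eq _ := .inl rfl
  edge_rel h := (HNNExtension.t_mul_of h).symm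
  eq_one_of_ne := fun hne => absurd rfl hne
  eq_top S hS ht := eq_top_iff.2 fun x _ => by
    induction x using HNNExtension.induction_on with
    | of g => exact hS () g
    | t => exact ht
    | mul x y hx hy => exact mul_mem (hx trivial) (hy trivial)
    | inv x hx => exact inv_mem (hx trivial)
  exists_lift _ _ f s hs _ := ⟨HNNExtension.lift (f ()) s fun h => (hs h).symm,
    fun _ => HNNExtension.lift_of _ _ _, HNNExtension.lift_t _ _ _⟩

theorem isOneEdgeSplitting_pushoutI {G : Fin 2 → Type u} [∀ i, Group (G i)] {H : Type u} [Group H]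
    (φ : ∀ i, H →* G i) :
    IsOneEdgeSplitting (φ 0) (φ 1) (fun i => PushoutI.of (φ := φ) i) 1 where
  eq_or_eq := by decide
  edge_rel h := by simp [PushoutI.of_apply_eq_base]
  eq_one_of_ne := fun _ => rfl
  eq_top S hS _ := eq_top_iff.2 fun x _ => by
    induction x using PushoutI.induction_on with
    | of i g => exact hS i g
    | base h => exact PushoutI.of_apply_eq_base φ 0 h ▸ hS 0 _
    | mul x y hx hy => exact mul_mem (hx trivial) (hy trivial)
  exists_lift _ _ f s hs hs1 := by
    obtain rfl := hs1 (by decide)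
    refine ⟨PushoutI.lift f ((f 0).comp (φ 0)) (Fin.forall_fin_two.2 ⟨rfl, ?_⟩), by simp, by simp⟩
    ext h
    simpa using hs h

theorem theorem3p5
    (C : (G : Type u) → [Group G] → Prop)
    (hC_iso : IsGroupClass C)
    (hC_prod : ClosedUnderFreeProducts C)
    (hC_index : ClosedUnderFiniteIndex C)
    (hC_int : C (ULift.{u} (Multiplicative ℤ)))
    (χ : (G : Type u) → [Group G] → ℝ)
    (hχ : IsEulerCharacteristic C χ)
    (hχ_prod : ∀ (A B : Type u) [Group A] [Group B], C A → C B →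
      χ (Monoid.Coprod A B) = χ A + χ B - 1) :
    (∀ (G : Type u) [Group G], C G → (Group.ResiduallyFinite G ∨ VirtuallyTorsionFree G) →
      ∀ (H H' : Subgroup G) [Finite H] (φ : H ≃* H'),
        VirtuallyIn C (HNNExtension G H H' φ) ∧
        wallExtension C χ (HNNExtension G H H' φ) = χ G - 1 / (Nat.card H : ℝ)) ∧
    (∀ (G : Fin 2 → Type u) [∀ i, Group (G i)], (∀ i, C (G i)) →
      (∀ i, Group.ResiduallyFinite (G i) ∨ VirtuallyTorsionFree (G i)) →
      ∀ (H : Type u) [Group H] [Finite H] (φ : ∀ i, H →* G i),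
        (∀ i, Function.Injective (φ i)) →
        VirtuallyIn C (Monoid.PushoutI φ) ∧
        wallExtension C χ (Monoid.PushoutI φ) = χ (G 0) + χ (G 1) - 1 / (Nat.card H : ℝ)) := by
  have h : IsFreelyAdditive C χ := ⟨hC_iso, hC_prod, hC_index, hC_int, hχ, hχ_prod⟩
  refine ⟨fun G _ hG hG' H H' _ φ => ?_, fun G _ hG hG' H _ _ φ hφ => ?_⟩
  · simpa using h.wallExtension_oneEdgeSplitting (isOneEdgeSplitting_hnnExtension φ)
      H.subtype_injective (H'.subtype_injective.comp φ.injective) (fun _ => hG) fun _ => hG'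
  · simpa using h.wallExtension_oneEdgeSplitting (isOneEdgeSplitting_pushoutI φ) (hφ 0)
      (hφ 1) hG hG'
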